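/- Let $\mathbf k$ be a field of characteristic $0$. A nonsymmetric operad $\mathcal P=(\mathcal P,\circ,\mathbb 1)$ is a family $\{\mathcal P_n\}_{n\ge 1}$ of $\mathbf k$-vector spaces with bilinear maps $\circ_i:\mathcal P_m\times\mathcal P_n\to\mathcal P_{m+n-1}$ ($1\le i\le m$) and an element $\mathbb 1\in\mathcal P_1$ such that $f\circ_i(g\circ_j h)=(f\circ_i g)\circ_{i+j-1}h$ for $f\in\mathcal P_m$, $g\in\mathcal P_n$, $1\le i\le m$, $1\le j\le n$; $(f\circ_i g)\circ_{j+n-1}h=(f\circ_j h)\circ_i g$ for $1\le i<j\le m$; and $f\circ_i\mathbb 1=\mathbb 1\circ_1 f=f$. An element $\pi\in\mathcal P_2$ is a multiplication on $\mathcal P$ if $\pi\circ_1\pi=\pi\circ_2\pi$, and then $r\in\mathcal P_1$ is an averaging element for $\pi$ if $(\pi\circ_2 r)\circ_1 r=r\circ_1(\pi\circ_1 r)=r\circ_1(\pi\circ_2 r)$. For $n\ge1$ let $Y_n$ be the set of planar binary trees with $n+1$ leaves, labelled $0,\dots,n$ from left to right, and let $d_i:Y_n\to Y_{n-1}$ delete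 the $i$-th leaf. For $m,n\ge1$, $1\le i\le m$ and $T\in Y_{m+n-1}$ put $$R_0^{m;i,n}(T)=(d_i d_{i+1}\cdots d_{i+n-2})(T)\in Y_m,\qquad R_i^{m;i,n}(T)=(d_0\cdots d_{i-2}\,d_{i+n}\cdots d_{m+n-1})(T)\in Y_n .$$ Let $\mathcal Q_n=\mathrm{Hom}(\mathbf k[Y_n],\mathcal P_n)$ and, for $F\in\mathcal Q_m$, $G\in\mathcal Q_n$, $$(F\circ_i^{\mathcal Q}G)(T)=F(R_0^{m;i,n}(T))\circ_i G(R_i^{m;i,n}(T)),\qquad T\in Y_{m+n-1}.$$ For $x\in\mathcal P_n$ let $\widetilde x\in\mathcal Q_n$ be the map sending every tree of $Y_n$ to $x$, and write $\pi^{\mathcal Q}=\widetilde\pi$. Let $Y_2=\{T_r,T_l\}$, where in $T_r$ the leaves $1,2$, and in $T_l$ the leaves $0,1$, have a common parent. Define $\theta^{\mathcal Q}:\mathcal Q_m\to\mathcal Q_{m+1}$ by $$(\theta^{\mathcal Q}F)(T)=\begin{cases}(-1)^m(\pi^{\mathcal Q}\circ_2^{\mathcal Q}F)(T)&\text{if }R_0^{2;2,m}(T)=T_r,\\-(\pi^{\mathcal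 Q}\circ_1^{\mathcal Q}F)(T)&\text{if }R_0^{2;1,m}(T)=T_l,\\0&\text{otherwise}\end{cases}$$ (the first two cases exclude each other) and, for $F\in\mathcal Q_m$, $G\in\mathcal Q_n$, $$[\![F,G]\!]_{\mathsf D}=(\pi^{\mathcal Q}\circ_2^{\mathcal Q}G)\circ_1^{\mathcal Q}F-(-1)^{mn}(\pi^{\mathcal Q}\circ_2^{\mathcal Q}F)\circ_1^{\mathcal Q}G+\sum_{i=1}^n(-1)^{(i-1)m}\,G\circ_i^{\mathcal Q}\theta^{\mathcal Q}F-(-1)^{mn}\sum_{i=1}^m(-1)^{(i-1)n}\,F\circ_i^{\mathcal Q}\theta^{\mathcal Q}G\ \in\mathcal Q_{m+n}.$$ Let $\mathcal P$ be a nonsymmetric operad over $\mathbf k$ and $\pi\in\mathcal P_2$. Then: 1. $\mathcal Q=\{\mathcal Q_n\}_{n\ge1}$ with the partial compositions $\circ_i^{\mathcal Q}$ and the identity element $\widetilde{\mathbb 1}\in\mathcal Q_1$ is a nonsymmetric operad. 2. $\pi$ is a multiplication on $\mathcal P$ if and only if $\pi^{\mathcal Q}$ is a multiplication on $\mathcal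 Q$. 3. If $\pi$ is a multiplication on $\mathcal P$, then $(\mathcal Q_\bullet=\bigoplus_{n\ge1}\mathcal Q_n,[\![\ ,\ ]\!]_{\mathsf D})$, with $\mathcal Q_n$ in degree $n$, is a graded Lie algebra: the bracket is bilinear, graded skew-symmetric and satisfies the graded Jacobi identity. 4. If $\pi$ is a multiplication on $\mathcal P$, then $r\in\mathcal P_1$ is an averaging element for $\pi$ if and only if $\widetilde r\in\mathcal Q_1$ is a Maurer–Cartan element, i.e. $[\![\widetilde r,\widetilde r]\!]_{\mathsf D}=0$; moreover, every Maurer–Cartan element of $(\mathcal Q_\bullet,[\![\ ,\ ]\!]_{\mathsf D})$ is of the form $\widetilde r$ for an averaging element $r$. -/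

import Mathlib

namespace AveragingOperad

universe u v

/-! ### Nonsymmetric operads

The spaces of a nonsymmetric operad are a family `P : ℕ → Type v`, where `P n` is the space of
operations of arity `n`. Only the arities `n ≥ 1` are used: no axiom and no construction below
says anything about `P 0`. -/

/-- `Composable m n l i` says that `∘ᵢ : P m × P n → P l` is one of the partial compositions of an
operad: `m, n ≥ 1`, `1 ≤ i ≤ m` and `l = m + n - 1`. -/
abbrev Composable (m n l i : ℕ) : Prop :=
  1 ≤ i ∧ i ≤ m ∧ 1 ≤ n ∧ m + n = l + 1

/-- The data of a nonsymmetric operad: partial compositions and an element of arity one. The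
target arity `l` is a variable tied to `m + n - 1` by a proof, which spares all transports along
equalities of arities. -/
structure OperadData (P : ℕ → Type v) where
  /-- The partial composition `f ∘ᵢ g`, for `f` of arity `m` and `g` of arity `n`. -/
  comp : ∀ {m n l : ℕ} (i : ℕ), Composable m n l i → P m → P n → P l
  /-- The identity element. -/
  one : P 1

/-- The axioms of a nonsymmetric operad: the partial compositions are bilinear, satisfy the
sequential and the parallel associativity law, and have a two-sided identity. -/
structure IsNSOperad (k : Type u) [Field k] {P : ℕ → Type v} [∀ n, AddCommGroup (P n)]
    [∀ n, Module k (P n)] (O : OperadData P) : Prop where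
  add_comp : ∀ {m n l i : ℕ} (h : Composable m n l i) (f f' : P m) (g : P n),
    O.comp i h (f + f') g = O.comp i h f g + O.comp i h f' g
  smul_comp : ∀ {m n l i : ℕ} (h : Composable m n l i) (c : k) (f : P m) (g : P n),
    O.comp i h (c • f) g = c • O.comp i h f g
  comp_add : ∀ {m n l i : ℕ} (h : Composable m n l i) (f : P m) (g g' : P n),
    O.comp i h f (g + g') = O.comp i h f g + O.comp i h f g'
  comp_smul : ∀ {m n l i : ℕ} (h : Composable m n l i) (c : k) (f : P m) (g : P n),
    O.comp i h f (c • g) = c • O.comp i h f g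
  /-- `f ∘ᵢ (g ∘ⱼ h) = (f ∘ᵢ g) ∘ᵢ₊ⱼ₋₁ h` -/
  comp_seq : ∀ {m n p a b l i j : ℕ} (hgh : Composable n p a j) (hf : Composable m a l i)
    (hfg : Composable m n b i) (hh : Composable b p l (i + j - 1))
    (f : P m) (g : P n) (h : P p),
    O.comp i hf f (O.comp j hgh g h) = O.comp (i + j - 1) hh (O.comp i hfg f g) h
  /-- `(f ∘ᵢ g) ∘ⱼ₊ₙ₋₁ h = (f ∘ⱼ h) ∘ᵢ g` for `i < j` -/
  comp_par : ∀ {m n p a b l i j : ℕ} (_ : i < j)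
    (hfg : Composable m n a i) (hh : Composable a p l (j + n - 1))
    (hfh : Composable m p b j) (hg : Composable b n l i)
    (f : P m) (g : P n) (h : P p),
    O.comp (j + n - 1) hh (O.comp i hfg f g) h = O.comp i hg (O.comp j hfh f h) g
  comp_one : ∀ {m i : ℕ} (h : Composable m 1 m i) (f : P m), O.comp i h f O.one = f
  one_comp : ∀ {m : ℕ} (h : Composable 1 m m 1) (f : P m), O.comp 1 h O.one f = f

section Operations

variable {P : ℕ → Type v} (O : OperadData P)

/-- `π` is a multiplication: `π ∘₁ π = π ∘₂ π`. -/
def IsMultiplication (π : P 2) : Prop :=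
  O.comp (l := 3) 1 (by omega) π π = O.comp (l := 3) 2 (by omega) π π

/-- `r` is an averaging element for `π`:
`(π ∘₂ r) ∘₁ r = r ∘₁ (π ∘₁ r) = r ∘₁ (π ∘₂ r)`. -/
def IsAveragingElement (π : P 2) (r : P 1) : Prop :=
  O.comp (l := 2) 1 (by omega) (O.comp (l := 2) 2 (by omega) π r) r =
      O.comp (l := 2) 1 (by omega) r (O.comp (l := 2) 1 (by omega) π r) ∧
    O.comp (l := 2) 1 (by omega) r (O.comp (l := 2) 1 (by omega) π r) =
      O.comp (l := 2) 1 (by omega) r (O.comp (l := 2) 2 (by omega) π r)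

/-- The cup product `f ∪ g = (π ∘₂ g) ∘₁ f`. -/
def cup (π : P 2) {m n l : ℕ} (hm : 1 ≤ m) (hn : 1 ≤ n) (h : m + n = l) (f : P m) (g : P n) :
    P l :=
  O.comp (l := l) 1 (by omega) (O.comp (l := n + 1) 2 (by omega) π g) f

variable [∀ n, AddCommGroup (P n)]

/-- The contraction `ι_g f = ∑_{i=1}^{m} (-1)^{(i-1)(n-1)} f ∘ᵢ g`; the summation index below is
`i - 1`. -/
def contraction {m n l : ℕ} (hn : 1 ≤ n) (h : m + n = l + 1) (g : P n) (f : P m) : P l :=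
  ∑ i : Fin m, (-1 : ℤ) ^ ((i : ℕ) * (n - 1)) •
    O.comp (l := l) ((i : ℕ) + 1) (by omega) f g

/-- The cup bracket `[f, g]_π = f ∪ g - (-1)^{mn} g ∪ f`. -/
def cupBracket (π : P 2) {m n l : ℕ} (hm : 1 ≤ m) (hn : 1 ≤ n) (h : m + n = l)
    (f : P m) (g : P n) : P l :=
  cup O π hm hn h f g - (-1 : ℤ) ^ (m * n) • cup O π hn hm (by omega) g f

end Operations

/-! ### Planar binary trees -/

/-- `PBT n` is the set `Y_n` of planar binary trees with `n` interior vertices, equivalently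
`n + 1` leaves. -/
abbrev PBT (n : ℕ) : Type := {t : BinaryTree Unit // t.numNodes = n}

/-- Delete the `i`-th leaf, the leaves being labelled `0, 1, 2, …` from left to right: the parent
of the leaf disappears and the sibling subtree takes its place. -/
def deleteLeaf : BinaryTree Unit → ℕ → BinaryTree Unit
  | .nil, _ => .nil
  | .node _ a b, i =>
    if i < a.numLeaves then
      if a = .nil then b else .node () (deleteLeaf a i) b
    else
      if b = .nil then a else .node () a (deleteLeaf b (i - a.numLeaves))

theorem numNodes_deleteLeaf (t : BinaryTree Unit) (i : ℕ) :
    (deleteLeaf t i).numNodes = t.numNodes - 1 := by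
  induction t generalizing i with
  | nil => rfl
  | node x a b iha ihb =>
    have pos : ∀ c : BinaryTree Unit, c ≠ .nil → 1 ≤ c.numNodes := by
      intro c hc
      cases c with
      | nil => exact absurd rfl hc
      | node => simp [BinaryTree.numNodes]
    rw [deleteLeaf]
    split_ifs with h1 h2 h3
    · subst h2; simp [BinaryTree.numNodes]
    · have := pos a h2
      simp only [BinaryTree.numNodes, iha]; omega
    · subst h3; simp [BinaryTree.numNodes]
    · have := pos b h3
      simp only [BinaryTree.numNodes, ihb]; omega

/-- `deleteLeaves t i c = (d_i d_{i+1} ⋯ d_{i+c-1}) t`, where `d_j` deletes the `j`-th leaf. -/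
def deleteLeaves (t : BinaryTree Unit) (i : ℕ) : ℕ → BinaryTree Unit
  | 0 => t
  | c + 1 => deleteLeaves (deleteLeaf t (i + c)) i c

theorem numNodes_deleteLeaves (t : BinaryTree Unit) (i c : ℕ) :
    (deleteLeaves t i c).numNodes = t.numNodes - c := by
  induction c generalizing t with
  | zero => rfl
  | succ c ih => rw [deleteLeaves, ih, numNodes_deleteLeaf]; omega

/-- `R_0^{m;i,n} = d_i d_{i+1} ⋯ d_{i+n-2} : Y_{m+n-1} → Y_m`. -/
def outerTree {m n l i : ℕ} (h : Composable m n l i) (T : PBT l) : PBT m :=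
  ⟨deleteLeaves T.1 i (n - 1), by rw [numNodes_deleteLeaves, T.2]; omega⟩

/-- `R_i^{m;i,n} = d_0 ⋯ d_{i-2} d_{i+n} ⋯ d_{m+n-1} : Y_{m+n-1} → Y_n`. -/
def innerTree {m n l i : ℕ} (h : Composable m n l i) (T : PBT l) : PBT n :=
  ⟨deleteLeaves (deleteLeaves T.1 (i + n) (m - i)) 0 (i - 1), by
    rw [numNodes_deleteLeaves, numNodes_deleteLeaves, T.2]; omega⟩

/-- The tree of `Y_2` whose leaves `1` and `2` have a common parent. -/
def rightTree : PBT 2 := ⟨.node () .nil (.node () .nil .nil), rfl⟩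

/-- The tree of `Y_2` whose leaves `0` and `1` have a common parent. -/
def leftTree : PBT 2 := ⟨.node () (.node () .nil .nil) .nil, rfl⟩

/-! ### The operad of tree-indexed operations -/

section Trees

variable (k : Type u) [Field k] {P : ℕ → Type v} [∀ n, AddCommGroup (P n)] [∀ n, Module k (P n)]

/-- `Q_n = Hom(k[Y_n], P_n)`. -/
abbrev TreeHom (P : ℕ → Type v) [∀ n, AddCommGroup (P n)] [∀ n, Module k (P n)] (n : ℕ) :
    Type (max u v) :=
  (PBT n →₀ k) →ₗ[k] P n

variable {k} in
/-- The value of `F` on a tree. -/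
noncomputable def TreeHom.val {n : ℕ} (F : TreeHom k P n) (T : PBT n) : P n :=
  F (Finsupp.single T 1)

/-- The linear map on `k[Y_n]` with prescribed values on trees. -/
noncomputable def TreeHom.mk {n : ℕ} (φ : PBT n → P n) : TreeHom k P n :=
  Finsupp.lift (P n) k (PBT n) φ

/-- The linear map on `k[Y_n]` that sends every tree to `x`. -/
noncomputable def TreeHom.const {n : ℕ} (x : P n) : TreeHom k P n :=
  TreeHom.mk k fun _ => x

/-- The partial compositions
`(F ∘ᵢ G)(T) = F (R_0^{m;i,n} T) ∘ᵢ G (R_i^{m;i,n} T)` on the spaces `Q_n`, and the element of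
`Q_1` that sends the only tree of `Y_1` to the identity of `P`. -/
noncomputable def treeOperad (O : OperadData P) : OperadData (TreeHom k P) where
  comp i h F G := TreeHom.mk k fun T => O.comp i h (F.val (outerTree h T)) (G.val (innerTree h T))
  one := TreeHom.const k O.one

variable (O : OperadData P) (π : P 2)

/-- The map `θ : Q_m → Q_{m+1}`. The two conditions on `T` say that its left, respectively right,
branch at the root is a single leaf; they exclude each other, and `θ F` vanishes on the trees
that satisfy neither. -/
noncomputable def treeTheta {m : ℕ} (hm : 1 ≤ m) (F : TreeHom k P m) : TreeHom k P (m + 1) :=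
  TreeHom.mk k fun T =>
    if outerTree (m := 2) (n := m) (i := 2) (by omega) T = rightTree then
      (-1 : ℤ) ^ m •
        ((treeOperad k O).comp (l := m + 1) 2 (by omega) (TreeHom.const k π) F).val T
    else if outerTree (m := 2) (n := m) (i := 1) (by omega) T = leftTree then
      -((treeOperad k O).comp (l := m + 1) 1 (by omega) (TreeHom.const k π) F).val T
    else 0

/-- The derived bracket
`⟦F, G⟧ = [F, G]_π + ι_{θF} G - (-1)^{mn} ι_{θG} F : Q_m × Q_n → Q_{m+n}`. -/
noncomputable def treeDerivedBracket {m n l : ℕ} (hm : 1 ≤ m) (hn : 1 ≤ n) (h : m + n = l)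
    (F : TreeHom k P m) (G : TreeHom k P n) : TreeHom k P l :=
  cupBracket (treeOperad k O) (TreeHom.const k π) hm hn h F G
    + contraction (treeOperad k O) (by omega) (by omega) (treeTheta k O π hm F) G
    - (-1 : ℤ) ^ (m * n) •
      contraction (treeOperad k O) (by omega) (by omega) (treeTheta k O π hn G) F

end Trees

/-! ### Graded Lie algebras -/

/-- A bracket `L_m × L_n → L_{m+n}`, for `m, n ≥ 1`, on a graded vector space concentrated in
positive degrees. -/
abbrev GradedBracket (L : ℕ → Type v) : Type v :=
  ∀ {m n l : ℕ}, 1 ≤ m → 1 ≤ n → m + n = l → L m → L n → L l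

/-- `br` makes `⨁_{n ≥ 1} L n` a graded Lie algebra (over a field of characteristic `0`): it is
bilinear, graded skew-symmetric, and satisfies the graded Jacobi identity. -/
structure IsGradedLieBracket (k : Type u) [Field k] {L : ℕ → Type v} [∀ n, AddCommGroup (L n)]
    [∀ n, Module k (L n)] (br : GradedBracket L) : Prop where
  add_left : ∀ {m n l : ℕ} (hm : 1 ≤ m) (hn : 1 ≤ n) (h : m + n = l) (x x' : L m) (y : L n),
    br hm hn h (x + x') y = br hm hn h x y + br hm hn h x' y
  smul_left : ∀ {m n l : ℕ} (hm : 1 ≤ m) (hn : 1 ≤ n) (h : m + n = l) (c : k) (x : L m) (y : L n),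
    br hm hn h (c • x) y = c • br hm hn h x y
  add_right : ∀ {m n l : ℕ} (hm : 1 ≤ m) (hn : 1 ≤ n) (h : m + n = l) (x : L m) (y y' : L n),
    br hm hn h x (y + y') = br hm hn h x y + br hm hn h x y'
  smul_right : ∀ {m n l : ℕ} (hm : 1 ≤ m) (hn : 1 ≤ n) (h : m + n = l) (c : k) (x : L m)
    (y : L n), br hm hn h x (c • y) = c • br hm hn h x y
  skew : ∀ {m n l : ℕ} (hm : 1 ≤ m) (hn : 1 ≤ n) (h : m + n = l) (x : L m) (y : L n),
    br hm hn h x y = -((-1 : ℤ) ^ (m * n) • br hn hm (by omega) y x)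
  /-- `[x, [y, z]] = [[x, y], z] + (-1)^{mn} [y, [x, z]]` -/
  jacobi : ∀ {m n p l : ℕ} (hm : 1 ≤ m) (hn : 1 ≤ n) (hp : 1 ≤ p) (h : m + n + p = l)
    (x : L m) (y : L n) (z : L p),
    br (n := n + p) hm (by omega) (by omega) x (br hn hp rfl y z) =
      br (m := m + n) (l := l) (by omega) hp h (br hm hn rfl x y) z +
        (-1 : ℤ) ^ (m * n) • br (n := m + p) hn (by omega) (by omega) y (br hm hp rfl x z)

/-- A Maurer–Cartan element of a graded Lie algebra: an element `x` of degree `1` with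
`[x, x] = 0`. -/
def IsMaurerCartan {L : ℕ → Type v} [∀ n, AddCommGroup (L n)] (br : GradedBracket L) (x : L 1) :
    Prop :=
  br (l := 2) le_rfl le_rfl rfl x x = 0

end AveragingOperad

/-!
For a multiplication `π`, the cup bracket `[ , ]_π` is a graded Lie bracket, and contractions make
the Gerstenhaber Lie algebra act on it by derivations. If `θ` raises arity by one and takes
`[f, g]_π + ι_{θf} g - (-1)^{mn} ι_{θg} f` to the Gerstenhaber bracket of `θf` and `θg`, that is, if
`θ` is a relative Rota–Baxter operator of weight one, then this descendent bracket is the bracket of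
the semidirect product carried to the graph of `θ`; hence it is a graded Lie bracket.

The map `θ` on tree-indexed operations is such an operator. The value of `θF` at `T` is that of
`(-1)^m π ∘₂ F` if the left branch of `T` at the root is a leaf, that of `-π ∘₁ F` if the right
branch is, and `0` otherwise. Evaluate `ι_{θF} θG` at `T`. If one of the two branches of `T` is a
leaf, then so is the same branch of every tree at which `θG` is evaluated. If neither is, only the
two extreme insertions survive, and they cancel against terms of `ι_{θG} θF`.

Finally, `Y_1` has a single tree, so every element of degree one is constant, and the values of
`⟦r, r⟧` at the two trees of `Y_2` are the two averaging equations, up to a factor of two.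
-/

namespace AveragingOperad

universe u v

/-! ### Cup products and contractions -/

theorem neg_one_pow_smul_smul {M : Type*} [AddCommGroup M] (n : ℕ) (x : M) :
    (-1 : ℤ) ^ n • (-1 : ℤ) ^ n • x = x := by
  rw [smul_smul, ← mul_pow, neg_one_mul, neg_neg, one_pow, one_smul]

theorem sum_range_eq_sum_three_blocks {M : Type*} [AddCommMonoid M] {p n i : ℕ}
    (hi : i < p) (φ : ℕ → M) :
    ∑ j ∈ Finset.range (p + n), φ j =
      ∑ j ∈ Finset.range (n + 1), φ (i + j) + ∑ j ∈ Finset.range i, φ j +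
        ∑ j ∈ Finset.Ico (i + 1) p, φ (n + j) := by
  rw [show p + n = i + (n + 1) + (p - (i + 1)) by omega, Finset.sum_range_add,
    Finset.sum_range_add, Finset.sum_Ico_eq_sum_range, add_comm (∑ j ∈ Finset.range i, φ j)]
  congr 1
  exact Finset.sum_congr rfl fun j _ => by congr 1; omega

section Calculus

variable {k : Type u} [Field k] {P : ℕ → Type v} [∀ n, AddCommGroup (P n)] [∀ n, Module k (P n)]
  {O : OperadData P} (hO : IsNSOperad k O) (π : P 2)

namespace IsNSOperad

/-- The partial composition `f ∘ᵢ₊₁ g` as a bilinear map, extended by `0` to all arities. The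
inputs are numbered from `0`. -/
noncomputable def circₗ {m n : ℕ} (l i : ℕ) : P m →ₗ[k] P n →ₗ[k] P l :=
  if h : Composable m n l (i + 1) then
    LinearMap.mk₂ k (O.comp (i + 1) h) (hO.add_comp h) (hO.smul_comp h) (hO.comp_add h)
      (hO.comp_smul h)
  else 0

/-- The cup product `f ∪ g = (π ∘₂ g) ∘₁ f` as a bilinear map, extended by `0` to all arities. -/
noncomputable def cupₗ {m n : ℕ} (l : ℕ) : P m →ₗ[k] P n →ₗ[k] P l :=
  (hO.circₗ l 0 ∘ₗ hO.circₗ (n + 1) 1 π).flip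

/-- The contraction `(g, f) ↦ ι_g f` as a bilinear map, extended by `0` to all arities. The
element `g` has arity `d + 1`, so that `d` is its degree in the sign rule. -/
noncomputable def contractionₗ {m d : ℕ} (l : ℕ) : P (d + 1) →ₗ[k] P m →ₗ[k] P l :=
  ∑ i ∈ Finset.range m, (-1 : ℤ) ^ (i * d) • (hO.circₗ l i).flip

/-- The cup bracket `[f, g]_π = f ∪ g - (-1)^{mn} g ∪ f` as a bilinear map, extended by `0` to all
arities. -/
noncomputable def cupBracketₗ {m n : ℕ} (l : ℕ) : P m →ₗ[k] P n →ₗ[k] P l :=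
  hO.cupₗ π l - (-1 : ℤ) ^ (m * n) • (hO.cupₗ π l).flip

/-- The Gerstenhaber bracket `ι_f g - (-1)^{mn} ι_g f` of operations of arities `m + 1` and
`n + 1`, extended by `0` to all arities. -/
noncomputable def gerstenhaberₗ {m n : ℕ} (l : ℕ) : P (m + 1) →ₗ[k] P (n + 1) →ₗ[k] P l :=
  hO.contractionₗ l - (-1 : ℤ) ^ (m * n) • (hO.contractionₗ l).flip

variable {m n p d : ℕ} {π}

theorem comp_eq_circₗ {l i : ℕ} (h : Composable m n l (i + 1)) (f : P m) (g : P n) :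
    O.comp (i + 1) h f g = hO.circₗ l i f g := by
  rw [circₗ, dif_pos h, LinearMap.mk₂_apply]

theorem cupₗ_apply (l : ℕ) (f : P m) (g : P n) :
    hO.cupₗ π l f g = hO.circₗ l 0 (hO.circₗ (n + 1) 1 π g) f :=
  rfl

theorem contractionₗ_apply (l : ℕ) (g : P (d + 1)) (f : P m) :
    hO.contractionₗ l g f = ∑ i ∈ Finset.range m, (-1 : ℤ) ^ (i * d) • hO.circₗ l i f g := by
  simp only [contractionₗ, LinearMap.sum_apply, LinearMap.smul_apply, LinearMap.flip_apply]

theorem cupBracketₗ_apply (l : ℕ) (f : P m) (g : P n) :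
    hO.cupBracketₗ π l f g = hO.cupₗ π l f g - (-1 : ℤ) ^ (m * n) • hO.cupₗ π l g f :=
  rfl

theorem gerstenhaberₗ_apply (l : ℕ) (f : P (m + 1)) (g : P (n + 1)) :
    hO.gerstenhaberₗ l f g =
      hO.contractionₗ l f g - (-1 : ℤ) ^ (m * n) • hO.contractionₗ l g f :=
  rfl

theorem contraction_eq_contractionₗ {l : ℕ} (hd : 1 ≤ d + 1) (h : m + (d + 1) = l + 1)
    (g : P (d + 1)) (f : P m) : contraction O hd h g f = hO.contractionₗ l g f := by
  rw [contraction, contractionₗ_apply, Finset.sum_range]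
  exact Finset.sum_congr rfl fun i _ => by rw [hO.comp_eq_circₗ, Nat.add_sub_cancel]

theorem cupBracket_eq_cupBracketₗ {l : ℕ} (hm : 1 ≤ m) (hn : 1 ≤ n) (h : m + n = l) (f : P m)
    (g : P n) : cupBracket O π hm hn h f g = hO.cupBracketₗ π l f g := by
  simp only [cupBracket, cup, hO.comp_eq_circₗ (i := 0), hO.comp_eq_circₗ (i := 1)]
  rfl

theorem circₗ_seq {a b l i j : ℕ}
    (h : i < m ∧ j < n ∧ 1 ≤ p ∧ n + p = a + 1 ∧ m + n = b + 1 ∧ m + a = l + 1)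
    (x : P m) (y : P n) (z : P p) :
    hO.circₗ l i x (hO.circₗ a j y z) = hO.circₗ l (i + j) (hO.circₗ b i x y) z := by
  have := hO.comp_seq (i := i + 1) (j := j + 1) (l := l) (a := a) (b := b) (by omega) (by omega)
    (by omega) (by omega) x y z
  simpa only [hO.comp_eq_circₗ, show i + 1 + (j + 1) - 1 = (i + j) + 1 by omega] using this

theorem circₗ_par {a b l i j j' : ℕ}
    (h : i < j ∧ j < m ∧ 1 ≤ n ∧ 1 ≤ p ∧ j' + 1 = j + n ∧ m + n = a + 1 ∧ m + p = b + 1 ∧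
      a + p = l + 1)
    (x : P m) (y : P n) (z : P p) :
    hO.circₗ l j' (hO.circₗ a i x y) z = hO.circₗ l i (hO.circₗ b j x z) y := by
  have := hO.comp_par (i := i + 1) (j := j + 1) (l := l) (a := a) (b := b) (by omega) (by omega)
    (by omega) (by omega) (by omega) x y z
  simpa only [hO.comp_eq_circₗ, show j + 1 + n - 1 = j' + 1 by omega] using this

theorem contractionₗ_cupₗ {s a b l : ℕ} (hm : 1 ≤ m) (hn : 1 ≤ n)
    (h : m + n = s ∧ m + d = a ∧ n + d = b ∧ s + d = l) (f : P (d + 1)) (x : P m) (y : P n) :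
    hO.contractionₗ l f (hO.cupₗ π s x y) =
      hO.cupₗ π l (hO.contractionₗ a f x) y +
        (-1 : ℤ) ^ (d * m) • hO.cupₗ π l x (hO.contractionₗ b f y) := by
  obtain ⟨rfl, rfl, rfl, rfl⟩ := h
  simp only [contractionₗ_apply, cupₗ_apply, map_sum, map_zsmul, LinearMap.sum_apply,
    LinearMap.smul_apply, Finset.smul_sum, smul_smul]
  rw [Finset.sum_range_add]
  congr 1 <;> refine Finset.sum_congr rfl fun i hi => ?_ <;> rw [Finset.mem_range] at hi
  · rw [hO.circₗ_seq (b := m + n) (by omega), Nat.zero_add]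
  · rw [hO.circₗ_par (i := 0) (j := i + 1) (b := n + d + 1) (by omega),
      hO.circₗ_seq (b := n + 1) (i := 1) (j := i) (by omega), ← pow_add, add_comm 1 i]
    ring_nf

theorem contractionₗ_cupBracketₗ {s a b l : ℕ} (hm : 1 ≤ m) (hn : 1 ≤ n)
    (h : m + n = s ∧ m + d = a ∧ n + d = b ∧ s + d = l) (f : P (d + 1)) (x : P m) (y : P n) :
    hO.contractionₗ l f (hO.cupBracketₗ π s x y) =
      hO.cupBracketₗ π l (hO.contractionₗ a f x) y +
        (-1 : ℤ) ^ (d * m) • hO.cupBracketₗ π l x (hO.contractionₗ b f y) := by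
  obtain ⟨rfl, rfl, rfl, rfl⟩ := h
  simp only [cupBracketₗ_apply, map_sub, map_zsmul,
    hO.contractionₗ_cupₗ (a := m + d) (b := n + d) hm hn ⟨rfl, rfl, rfl, rfl⟩,
    hO.contractionₗ_cupₗ (a := n + d) (b := m + d) hn hm ⟨add_comm n m, rfl, rfl, rfl⟩]
  rcases neg_one_pow_eq_or ℤ (d * m) with e | e <;>
    simp only [mul_add, add_mul, pow_add, mul_comm m d, e, mul_neg, mul_one, neg_smul, one_smul] <;>
    module

/-- The part of `ι_f ι_g h` in which `f` and `g` are inserted side by side, `f` before `g`. -/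
noncomputable def parallelInsertion (l : ℕ) (f : P (m + 1)) (g : P (n + 1)) (h : P p) : P l :=
  ∑ i ∈ Finset.range p, ∑ j ∈ Finset.range i,
    (-1 : ℤ) ^ (i * n + j * m) • hO.circₗ l j (hO.circₗ (p + n) i h g) f

theorem contractionₗ_contractionₗ {s t l : ℕ} (h : p + n = s ∧ n + m = t ∧ s + m = l)
    (f : P (m + 1)) (g : P (n + 1)) (x : P p) :
    hO.contractionₗ l f (hO.contractionₗ s g x) =
      hO.contractionₗ l (hO.contractionₗ (t + 1) f g) x + hO.parallelInsertion l f g x +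
        (-1 : ℤ) ^ (m * n) • hO.parallelInsertion l g f x := by
  obtain ⟨rfl, rfl, rfl⟩ := h
  have double_sum : hO.contractionₗ (p + n + m) f (hO.contractionₗ (p + n) g x) =
      ∑ i ∈ Finset.range p, ∑ j ∈ Finset.range (p + n),
        (-1 : ℤ) ^ (i * n + j * m) •
          hO.circₗ (p + n + m) j (hO.circₗ (p + n) i x g) f := by
    simp only [contractionₗ_apply, map_sum, map_zsmul, Finset.smul_sum, smul_smul, ← pow_add]
  rw [double_sum, Finset.sum_congr rfl fun i hi =>
    sum_range_eq_sum_three_blocks (Finset.mem_range.1 hi) _]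
  simp only [Finset.sum_add_distrib]
  congr 2
  · simp only [contractionₗ_apply, map_sum, map_zsmul, LinearMap.sum_apply, LinearMap.smul_apply,
      Finset.smul_sum, smul_smul]
    rw [Finset.sum_comm]
    refine Finset.sum_congr rfl fun i hi => Finset.sum_congr rfl fun j hj => ?_
    rw [Finset.mem_range] at hi hj
    rw [hO.circₗ_seq (b := p + n) (by omega), ← pow_add]
    ring_nf
  · simp only [parallelInsertion, Finset.smul_sum, smul_smul]
    rw [Finset.sum_comm' (t' := Finset.range p) (s' := fun i => Finset.range i)
      (by simp only [Finset.mem_range, Finset.mem_Ico]; omega)]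
    refine Finset.sum_congr rfl fun i hi => Finset.sum_congr rfl fun j hj => ?_
    rw [Finset.mem_range] at hi hj
    rw [hO.circₗ_par (i := j) (j := i) (b := p + m) (by omega), ← pow_add]
    ring_nf

theorem contractionₗ_gerstenhaberₗ {s s' t l : ℕ}
    (h : p + n = s ∧ p + m = s' ∧ n + m = t ∧ s + m = l)
    (f : P (m + 1)) (g : P (n + 1)) (x : P p) :
    hO.contractionₗ l (hO.gerstenhaberₗ (t + 1) f g) x =
      hO.contractionₗ l f (hO.contractionₗ s g x) -
        (-1 : ℤ) ^ (m * n) • hO.contractionₗ l g (hO.contractionₗ s' f x) := by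
  rw [hO.contractionₗ_contractionₗ (t := t) (by omega),
    hO.contractionₗ_contractionₗ (t := t) (by omega), gerstenhaberₗ_apply, map_sub, map_zsmul,
    LinearMap.sub_apply, LinearMap.smul_apply, mul_comm n m]
  simp only [smul_add, neg_one_pow_smul_smul]
  abel

theorem cupBracketₗ_skew (l : ℕ) (x : P m) (y : P n) :
    hO.cupBracketₗ π l x y = -((-1 : ℤ) ^ (m * n) • hO.cupBracketₗ π l y x) := by
  simp only [cupBracketₗ_apply, smul_sub, mul_comm n m, neg_one_pow_smul_smul, neg_sub]

end IsNSOperad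

end Calculus

section Multiplication

variable {k : Type u} [Field k] {P : ℕ → Type v} [∀ n, AddCommGroup (P n)] [∀ n, Module k (P n)]
  {O : OperadData P} (hO : IsNSOperad k O) {π : P 2} {m n p : ℕ}

namespace IsMultiplication

variable (hπ : IsMultiplication O π)
include hπ

theorem circₗ_self : hO.circₗ 3 0 π π = hO.circₗ 3 1 π π := by
  simpa only [IsMultiplication, hO.comp_eq_circₗ (i := 0), hO.comp_eq_circₗ (i := 1)] using hπ

theorem circₗ_right_mul {a l : ℕ} (hn : 1 ≤ n) (h : n + 1 = a ∧ n + 2 = l) (g : P n) :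
    hO.circₗ l 0 (hO.circₗ a 1 π g) π = hO.circₗ l 1 π (hO.circₗ a 1 π g) := by
  rw [hO.circₗ_seq (b := 3) (by omega), ← hπ.circₗ_self hO]
  exact (hO.circₗ_par (by omega) π π g).symm

theorem circₗ_right_right {a b s l : ℕ} (hm : 1 ≤ m) (hn : 1 ≤ n)
    (h : n + 1 = a ∧ m + 1 = b ∧ m + n = s ∧ s + 1 = l) (f : P m) (g : P n) :
    hO.circₗ l 0 (hO.circₗ a 1 π g) (hO.circₗ b 1 π f) = hO.circₗ l 1 π (hO.cupₗ π s f g) := by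
  obtain ⟨rfl, rfl, rfl, rfl⟩ := h
  rw [hO.circₗ_seq (b := n + 2) (by omega), hπ.circₗ_right_mul hO hn ⟨rfl, rfl⟩, hO.cupₗ_apply,
    hO.circₗ_seq (b := n + 2) (i := 1) (j := 0) (by omega)]

theorem circₗ_left_left {a b s l : ℕ} (hm : 1 ≤ m) (hn : 1 ≤ n)
    (h : n + 1 = a ∧ m + 1 = b ∧ m + n = s ∧ s + 1 = l) (f : P m) (g : P n) :
    hO.circₗ l n (hO.circₗ a 0 π g) (hO.circₗ b 0 π f) = hO.circₗ l 0 π (hO.cupₗ π s g f) := by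
  rw [hO.circₗ_par (i := 0) (j := 1) (b := m + 2) (by omega),
    hO.circₗ_seq (b := 3) (i := 1) (j := 0) (by omega), ← hπ.circₗ_self hO, hO.cupₗ_apply,
    hO.circₗ_seq (b := m + 2) (i := 0) (j := 0) (by omega),
    hO.circₗ_seq (b := 3) (i := 0) (j := 1) (by omega)]

theorem circₗ_right_left {a b l : ℕ} (hm : 1 ≤ m) (hn : 1 ≤ n)
    (h : n + 1 = a ∧ m + 1 = b ∧ m + n + 1 = l) (f : P m) (g : P n) :
    hO.circₗ l 0 (hO.circₗ a 1 π g) (hO.circₗ b 0 π f) =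
      hO.circₗ l m (hO.circₗ b 0 π f) (hO.circₗ a 1 π g) := by
  rw [hO.circₗ_par (i := 0) (j := 1) (b := n + 2) (by omega),
    ← hπ.circₗ_right_mul hO hn ⟨h.1, rfl⟩,
    hO.circₗ_seq (b := n + 2) (i := 0) (j := 0) (by omega)]

theorem cupₗ_assoc {s t l : ℕ} (hm : 1 ≤ m) (hn : 1 ≤ n) (hp : 1 ≤ p)
    (h : m + n = s ∧ n + p = t ∧ m + t = l) (f : P m) (g : P n) (x : P p) :
    hO.cupₗ π l (hO.cupₗ π s f g) x = hO.cupₗ π l f (hO.cupₗ π t g x) := by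
  rw [hO.cupₗ_apply, hO.cupₗ_apply, hO.circₗ_seq (b := t + 1) (i := 0) (j := 0) (by omega),
    hπ.circₗ_right_right hO hn hp (s := t) (by omega), hO.cupₗ_apply l f]

theorem cupBracketₗ_jacobi {s t u l : ℕ} (hm : 1 ≤ m) (hn : 1 ≤ n) (hp : 1 ≤ p)
    (h : m + n = s ∧ n + p = t ∧ m + p = u ∧ m + n + p = l) (x : P m) (y : P n) (z : P p) :
    hO.cupBracketₗ π l x (hO.cupBracketₗ π t y z) =
      hO.cupBracketₗ π l (hO.cupBracketₗ π s x y) z +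
        (-1 : ℤ) ^ (m * n) • hO.cupBracketₗ π l y (hO.cupBracketₗ π u x z) := by
  have assoc {a b c s t : ℕ} (ha : 1 ≤ a) (hb : 1 ≤ b) (hc : 1 ≤ c)
      (h : a + b = s ∧ b + c = t ∧ a + t = l) (f : P a) (g : P b) (x : P c) :=
    hπ.cupₗ_assoc hO ha hb hc h f g x
  obtain ⟨rfl, rfl, rfl, rfl⟩ := h
  simp only [IsNSOperad.cupBracketₗ_apply, map_sub, map_zsmul, LinearMap.sub_apply,
    LinearMap.smul_apply]
  rw [assoc (t := n + p) hm hn hp (by omega), assoc (t := m + p) hn hm hp (by omega),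
    assoc (t := m + p) hn hp hm (by omega), assoc (t := m + n) hp hn hm (by omega),
    assoc (t := n + p) hm hp hn (by omega), assoc (t := m + n) hp hm hn (by omega)]
  simp only [mul_add, add_mul, pow_add, mul_comm n m]
  rcases neg_one_pow_eq_or ℤ (m * n) with e | e <;>
    simp only [e, one_mul, neg_mul, neg_smul, one_smul] <;> module

end IsMultiplication

namespace IsNSOperad

variable (π)

/-- `(-1)ⁿ π ∘₂ g`, for `g` of arity `n`: the value of `θ g` on the trees whose left branch at the
root is a leaf. -/
noncomputable def rightGraft (n : ℕ) : P n →ₗ[k] P (n + 1) :=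
  (-1 : ℤ) ^ n • hO.circₗ (n + 1) 1 π

/-- `-π ∘₁ g`, for `g` of arity `n`: the value of `θ g` on the trees whose right branch at the root
is a leaf. -/
noncomputable def leftGraft (n : ℕ) : P n →ₗ[k] P (n + 1) :=
  -hO.circₗ (n + 1) 0 π

theorem rightGraft_apply (g : P n) :
    hO.rightGraft π n g = (-1 : ℤ) ^ n • hO.circₗ (n + 1) 1 π g :=
  rfl

theorem leftGraft_apply (g : P n) : hO.leftGraft π n g = -hO.circₗ (n + 1) 0 π g :=
  rfl

theorem contractionₗ_rightGraft {d s : ℕ} (h : n + d = s) (f : P (d + 1)) (g : P n) :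
    hO.contractionₗ (s + 1) f (hO.rightGraft π n g) =
      hO.circₗ (s + 1) 0 (hO.rightGraft π n g) f +
        hO.rightGraft π s (hO.contractionₗ s f g) := by
  subst h
  rw [contractionₗ_apply, Finset.sum_range_succ', zero_mul, pow_zero, one_smul,
    add_comm (∑ _ ∈ _, _), rightGraft_apply hO π (hO.contractionₗ (n + d) f g),
    contractionₗ_apply, map_sum, Finset.smul_sum]
  refine congrArg (_ + ·) (Finset.sum_congr rfl fun i hi => ?_)
  rw [Finset.mem_range] at hi
  rw [rightGraft_apply, map_zsmul, map_zsmul, LinearMap.smul_apply,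
    hO.circₗ_seq (b := n + 1) (i := 1) (j := i) (by omega), smul_smul, smul_smul, ← pow_add,
    ← pow_add, add_comm 1 i]
  ring_nf

theorem contractionₗ_leftGraft {d s : ℕ} (h : n + d = s) (f : P (d + 1)) (g : P n) :
    hO.contractionₗ (s + 1) f (hO.leftGraft π n g) =
      hO.leftGraft π s (hO.contractionₗ s f g) +
        (-1 : ℤ) ^ (n * d) • hO.circₗ (s + 1) n (hO.leftGraft π n g) f := by
  subst h
  rw [contractionₗ_apply, Finset.sum_range_succ, leftGraft_apply hO π (hO.contractionₗ _ f g),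
    contractionₗ_apply, map_sum, ← Finset.sum_neg_distrib]
  refine congrArg (· + _) (Finset.sum_congr rfl fun i hi => ?_)
  rw [Finset.mem_range] at hi
  rw [leftGraft_apply, map_neg, map_zsmul, LinearMap.neg_apply, smul_neg,
    hO.circₗ_seq (b := n + 1) (i := 0) (j := i) (by omega), zero_add]

end IsNSOperad

namespace IsMultiplication

variable (hπ : IsMultiplication O π)
include hπ

theorem circₗ_rightGraft_rightGraft {s : ℕ} (hm : 1 ≤ m) (hn : 1 ≤ n) (h : m + n = s) (f : P m)
    (g : P n) :
    hO.circₗ (s + 1) 0 (hO.rightGraft π n g) (hO.rightGraft π m f) =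
      hO.rightGraft π s (hO.cupₗ π s f g) := by
  simp only [IsNSOperad.rightGraft_apply, map_zsmul, LinearMap.smul_apply]
  rw [hπ.circₗ_right_right hO hm hn ⟨rfl, rfl, h, rfl⟩, smul_smul, ← pow_add, h]

theorem circₗ_leftGraft_leftGraft {s : ℕ} (hm : 1 ≤ m) (hn : 1 ≤ n) (h : m + n = s) (f : P m)
    (g : P n) :
    hO.circₗ (s + 1) n (hO.leftGraft π n g) (hO.leftGraft π m f) =
      -hO.leftGraft π s (hO.cupₗ π s g f) := by
  simp only [IsNSOperad.leftGraft_apply, map_neg, LinearMap.neg_apply]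
  rw [hπ.circₗ_left_left hO hm hn ⟨rfl, rfl, h, rfl⟩]

theorem circₗ_rightGraft_leftGraft {s : ℕ} (hm : 1 ≤ m) (hn : 1 ≤ n) (h : m + n = s) (f : P m)
    (g : P n) :
    hO.circₗ (s + 1) 0 (hO.rightGraft π n g) (hO.leftGraft π m f) =
      hO.circₗ (s + 1) m (hO.leftGraft π m f) (hO.rightGraft π n g) := by
  simp only [IsNSOperad.rightGraft_apply, IsNSOperad.leftGraft_apply, map_zsmul, map_neg,
    LinearMap.neg_apply, LinearMap.smul_apply, smul_neg]
  rw [hπ.circₗ_right_left hO hm hn ⟨rfl, rfl, by rw [h]⟩]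

end IsMultiplication

end Multiplication

/-! ### Descendent brackets of relative Rota–Baxter operators -/

section DescendentBracket

variable {k : Type u} [Field k] {P : ℕ → Type v} [∀ n, AddCommGroup (P n)] [∀ n, Module k (P n)]
  {O : OperadData P} (hO : IsNSOperad k O) {π : P 2} {m n p : ℕ}

/-- The descendent bracket `[f, g]_π + ι_{θf} g - (-1)^{mn} ι_{θg} f` of a family of maps
`θ : P m → P (m + 1)`. -/
def descendentBracket (O : OperadData P) (π : P 2) (θ : ∀ {m : ℕ}, 1 ≤ m → P m → P (m + 1)) :
    GradedBracket P := fun {m n _} hm hn h f g =>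
  cupBracket O π hm hn h f g + contraction O (by omega) (by omega) (θ hm f) g -
    (-1 : ℤ) ^ (m * n) • contraction O (by omega) (by omega) (θ hn g) f

variable (k) in
theorem isMaurerCartan_descendentBracket_iff [NeZero (2 : k)]
    (θ : ∀ {m : ℕ}, 1 ≤ m → P m → P (m + 1)) (r : P 1) :
    IsMaurerCartan (descendentBracket O π θ) r ↔
      O.comp (l := 2) 1 (by omega) (O.comp (l := 2) 2 (by omega) π r) r =
        -O.comp (l := 2) 1 (by omega) r (θ le_rfl r) := by
  have bracket : descendentBracket O π θ (l := 2) le_rfl le_rfl rfl r r =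
      (2 : k) • (O.comp (l := 2) 1 (by omega) (O.comp (l := 2) 2 (by omega) π r) r +
        O.comp (l := 2) 1 (by omega) r (θ le_rfl r)) := by
    simp only [descendentBracket, cupBracket, cup, contraction, Fin.sum_univ_one, Fin.val_zero,
      zero_mul, zero_add, one_mul, pow_zero, pow_one, one_smul, neg_smul]
    module
  rw [IsMaurerCartan, bracket, smul_eq_zero_iff_right two_ne_zero, add_eq_zero_iff_eq_neg]

/-- `θ` is a relative Rota–Baxter operator of weight one, from the cup bracket to the Gerstenhaber
bracket acting on it by contractions: it is linear and takes its descendent bracket to the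
Gerstenhaber bracket. -/
structure IsRelativeRotaBaxter (π : P 2)
    (θ : ∀ {m : ℕ}, 1 ≤ m → P m → P (m + 1)) : Prop where
  apply_add : ∀ {m : ℕ} (hm : 1 ≤ m) (f f' : P m), θ hm (f + f') = θ hm f + θ hm f'
  apply_smul : ∀ {m : ℕ} (hm : 1 ≤ m) (c : k) (f : P m), θ hm (c • f) = c • θ hm f
  apply_descendentBracket : ∀ {m n : ℕ} (hm : 1 ≤ m) (hn : 1 ≤ n) (f : P m) (g : P n),
    θ (Nat.le_add_right_of_le hm) (descendentBracket O π θ hm hn rfl f g) =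
      hO.gerstenhaberₗ (m + n + 1) (θ hm f) (θ hn g)

theorem IsNSOperad.descendentBracket_eq (θ : ∀ {m : ℕ}, 1 ≤ m → P m → P (m + 1)) {l : ℕ}
    (hm : 1 ≤ m) (hn : 1 ≤ n) (h : m + n = l) (f : P m) (g : P n) :
    descendentBracket O π θ hm hn h f g =
      hO.cupBracketₗ π l f g + hO.contractionₗ l (θ hm f) g -
        (-1 : ℤ) ^ (m * n) • hO.contractionₗ l (θ hn g) f := by
  simp only [descendentBracket, hO.cupBracket_eq_cupBracketₗ, hO.contraction_eq_contractionₗ]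

namespace IsRelativeRotaBaxter

variable {hO} {θ : ∀ {m : ℕ}, 1 ≤ m → P m → P (m + 1)} (hθ : IsRelativeRotaBaxter hO π θ)
include hθ

theorem descendentBracket_jacobi (hπ : IsMultiplication O π) {l : ℕ} (hm : 1 ≤ m) (hn : 1 ≤ n)
    (hp : 1 ≤ p) (h : m + n + p = l) (x : P m) (y : P n) (z : P p) :
    descendentBracket O π θ (n := n + p) hm (by omega) (by omega) x
        (descendentBracket O π θ hn hp rfl y z) =
      descendentBracket O π θ (m := m + n) (by omega) hp h
          (descendentBracket O π θ hm hn rfl x y) z +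
        (-1 : ℤ) ^ (m * n) • descendentBracket O π θ (n := m + p) hn (by omega) (by omega) y
          (descendentBracket O π θ hm hp rfl x z) := by
  rw [hO.descendentBracket_eq θ hm (n := n + p), hO.descendentBracket_eq θ (m := m + n) _ hp,
    hO.descendentBracket_eq θ hn (n := m + p)]
  simp only [hθ.apply_descendentBracket]
  rw [hO.contractionₗ_gerstenhaberₗ (s := m + p) (s' := m + n) (by omega),
    hO.contractionₗ_gerstenhaberₗ (s := n + p) (s' := m + p) (by omega),
    hO.contractionₗ_gerstenhaberₗ (s := n + p) (s' := m + n) (by omega)]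
  simp only [hO.descendentBracket_eq, map_add, map_sub, map_zsmul, LinearMap.add_apply,
    LinearMap.sub_apply, LinearMap.smul_apply]
  rw [hπ.cupBracketₗ_jacobi hO hm hn hp ⟨rfl, rfl, rfl, h⟩,
    hO.contractionₗ_cupBracketₗ (a := m + n) (b := m + p) hn hp (by omega) (θ hm x),
    hO.contractionₗ_cupBracketₗ (a := m + n) (b := n + p) hm hp (by omega) (θ hn y),
    hO.contractionₗ_cupBracketₗ (a := m + p) (b := n + p) hm hn (by omega) (θ hp z),
    hO.cupBracketₗ_skew l y (hO.contractionₗ (m + p) (θ hp z) x)]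
  simp only [mul_add, add_mul, pow_add, mul_comm n m, mul_comm p m]
  rcases neg_one_pow_eq_or ℤ (m * n) with e₁ | e₁ <;>
  rcases neg_one_pow_eq_or ℤ (m * p) with e₂ | e₂ <;>
  rcases neg_one_pow_eq_or ℤ (n * p) with e₃ | e₃ <;>
    (simp only [e₁, e₂, e₃]; module)

theorem isGradedLieBracket_descendentBracket (hπ : IsMultiplication O π) :
    IsGradedLieBracket k (L := P) (descendentBracket O π θ) where
  add_left hm hn h x x' y := by
    simp only [hO.descendentBracket_eq, hθ.apply_add, map_add, LinearMap.add_apply]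
    module
  smul_left hm hn h c x y := by
    simp only [hO.descendentBracket_eq, hθ.apply_smul, map_smul, LinearMap.smul_apply, smul_add,
      smul_sub, smul_comm _ c]
  add_right hm hn h x y y' := by
    simp only [hO.descendentBracket_eq, hθ.apply_add, map_add, LinearMap.add_apply]
    module
  smul_right hm hn h c x y := by
    simp only [hO.descendentBracket_eq, hθ.apply_smul, map_smul, LinearMap.smul_apply, smul_add,
      smul_sub, smul_comm _ c]
  skew {m n _} hm hn h x y := by
    rw [hO.descendentBracket_eq, hO.descendentBracket_eq, hO.cupBracketₗ_skew, mul_comm n m]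
    simp only [smul_add, smul_sub, neg_one_pow_smul_smul]
    abel
  jacobi hm hn hp h x y z := hθ.descendentBracket_jacobi hπ hm hn hp h x y z

end IsRelativeRotaBaxter

end DescendentBracket

/-! ### Deleting leaves -/

open BinaryTree (numLeaves_pos numLeaves_eq_numNodes_succ)

theorem eq_nil_iff_numLeaves {t : BinaryTree Unit} : t = .nil ↔ t.numLeaves = 1 := by
  cases t with
  | nil => exact iff_of_true rfl rfl
  | node => simp [numLeaves_eq_numNodes_succ]; omega

theorem numLeaves_deleteLeaf (t : BinaryTree Unit) (i : ℕ) :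
    (deleteLeaf t i).numLeaves = max 1 (t.numLeaves - 1) := by
  simp only [numLeaves_eq_numNodes_succ, numNodes_deleteLeaf]; omega

theorem numLeaves_deleteLeaves (t : BinaryTree Unit) (i c : ℕ) :
    (deleteLeaves t i c).numLeaves = max 1 (t.numLeaves - c) := by
  simp only [numLeaves_eq_numNodes_succ, numNodes_deleteLeaves]; omega

theorem deleteLeaf_node_of_lt (x : Unit) {a : BinaryTree Unit} (b : BinaryTree Unit) {i : ℕ}
    (hi : i < a.numLeaves) :
    deleteLeaf (.node x a b) i = if a.numLeaves = 1 then b else .node x (deleteLeaf a i) b := by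
  simp only [deleteLeaf, if_pos hi, eq_nil_iff_numLeaves]

theorem deleteLeaf_node_of_le (x : Unit) {a : BinaryTree Unit} (b : BinaryTree Unit) {i : ℕ}
    (hi : a.numLeaves ≤ i) :
    deleteLeaf (.node x a b) i =
      if b.numLeaves = 1 then a else .node x a (deleteLeaf b (i - a.numLeaves)) := by
  simp only [deleteLeaf, if_neg hi.not_gt, eq_nil_iff_numLeaves]

theorem deleteLeaf_comm (t : BinaryTree Unit) {i j : ℕ} (hij : i < j) (hj : j < t.numLeaves) :
    deleteLeaf (deleteLeaf t j) i = deleteLeaf (deleteLeaf t i) (j - 1) := by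
  induction t generalizing i j with
  | nil => rfl
  | node x a b iha ihb =>
    simp only [BinaryTree.numLeaves] at hj
    have left (k) := numLeaves_deleteLeaf a k
    rcases lt_or_ge j a.numLeaves with hja | hja
    · have hia := hij.trans hja
      rw [deleteLeaf_node_of_lt x b hja, deleteLeaf_node_of_lt x b hia, if_neg (by omega),
        if_neg (by omega), deleteLeaf_node_of_lt x b (by grind),
        deleteLeaf_node_of_lt x b (by grind), left, left, iha hij hja]
    rcases lt_or_ge i a.numLeaves with hia | hia
    · rw [deleteLeaf_node_of_le x b hja, deleteLeaf_node_of_lt x b hia]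
      by_cases hb : b.numLeaves = 1 <;> by_cases ha : a.numLeaves = 1
      · rw [if_pos hb, if_pos ha, eq_nil_iff_numLeaves.2 ha, eq_nil_iff_numLeaves.2 hb]
        rfl
      · rw [if_pos hb, if_neg ha, deleteLeaf_node_of_le x b (by grind), if_pos hb]
      · rw [if_neg hb, if_pos ha, deleteLeaf_node_of_lt x _ hia, if_pos ha, ha]
      · rw [if_neg hb, if_neg ha, deleteLeaf_node_of_lt x _ hia, if_neg ha,
          deleteLeaf_node_of_le x b (by grind), if_neg hb, left]
        grind
    · have right (k) := numLeaves_deleteLeaf b k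
      rw [deleteLeaf_node_of_le x b hja, deleteLeaf_node_of_le x b hia, if_neg (by omega),
        if_neg (by omega), deleteLeaf_node_of_le x _ hia, deleteLeaf_node_of_le x _ (by omega),
        right, right, ihb (by omega) (by omega), Nat.sub_right_comm]

theorem deleteLeaf_deleteLeaves (t : BinaryTree Unit) {i j c : ℕ} (hij : i < j)
    (hj : j + c ≤ t.numLeaves) :
    deleteLeaf (deleteLeaves t j c) i = deleteLeaves (deleteLeaf t i) (j - 1) c := by
  induction c generalizing t with
  | zero => rfl
  | succ c ih =>
    rw [deleteLeaves, deleteLeaves, ih _ (by rw [numLeaves_deleteLeaf]; omega),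
      deleteLeaf_comm t (by omega) (by omega), show j - 1 + c = j + c - 1 by omega]

theorem deleteLeaves_comm (t : BinaryTree Unit) {i j c e : ℕ} (hij : i + c ≤ j)
    (hj : j + e ≤ t.numLeaves) :
    deleteLeaves (deleteLeaves t j e) i c = deleteLeaves (deleteLeaves t i c) (j - c) e := by
  induction c generalizing t j with
  | zero => rfl
  | succ c ih =>
    rw [deleteLeaves, deleteLeaves, deleteLeaf_deleteLeaves t (by omega) hj,
      ih _ (by omega) (by rw [numLeaves_deleteLeaf]; omega), show j - 1 - c = j - (c + 1) by omega]

theorem deleteLeaves_add (t : BinaryTree Unit) (i c e : ℕ) :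
    deleteLeaves t i (c + e) = deleteLeaves (deleteLeaves t (i + c) e) i c := by
  induction e generalizing t with
  | zero => rfl
  | succ e ih => rw [← add_assoc, deleteLeaves, deleteLeaves, ih, add_assoc]

theorem deleteLeaves_deleteLeaves (t : BinaryTree Unit) {i j c e : ℕ} (hij : i ≤ j)
    (hji : j ≤ i + e) (h : i + e + c ≤ t.numLeaves) :
    deleteLeaves (deleteLeaves t j c) i e = deleteLeaves t i (e + c) := by
  obtain ⟨d, rfl⟩ := Nat.exists_eq_add_of_le hij
  obtain ⟨e', rfl⟩ := Nat.exists_eq_add_of_le (show d ≤ e by omega)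
  rw [deleteLeaves_add _ _ d e', show d + e' + c = d + (c + e') by omega,
    deleteLeaves_add t i d, deleteLeaves_add t (i + d) c,
    deleteLeaves_comm t (i := i + d) (j := i + d + c) le_rfl (by omega), Nat.add_sub_cancel]

/-- The number of leaves of the left branch at the root. It determines which case of the
definition of `θ` applies. -/
def leftLeaves (t : BinaryTree Unit) : ℕ := t.left.numLeaves

theorem leftLeaves_node (x : Unit) (a b : BinaryTree Unit) :
    leftLeaves (.node x a b) = a.numLeaves :=
  rfl

theorem leftLeaves_deleteLeaf {t : BinaryTree Unit} {i : ℕ}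
    (hl : leftLeaves t ≤ i ∨ 2 ≤ leftLeaves t)
    (hr : i < leftLeaves t ∨ leftLeaves t + 2 ≤ t.numLeaves) :
    leftLeaves (deleteLeaf t i) =
      leftLeaves t + min i (leftLeaves t) - min (i + 1) (leftLeaves t) := by
  cases t with
  | nil => grind [leftLeaves, BinaryTree.left, BinaryTree.numLeaves]
  | node x a b =>
    simp only [leftLeaves_node, BinaryTree.numLeaves] at hl hr ⊢
    rcases lt_or_ge i a.numLeaves with hi | hi
    · rw [deleteLeaf_node_of_lt x b hi, if_neg (by omega), leftLeaves_node, numLeaves_deleteLeaf]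
      omega
    · rw [deleteLeaf_node_of_le x b hi, if_neg (by omega), leftLeaves_node]
      omega

theorem leftLeaves_deleteLeaves {t : BinaryTree Unit} {i c : ℕ} (hc : i + c ≤ t.numLeaves)
    (hl : 0 < i ∨ c < leftLeaves t) (hr : leftLeaves t < i ∨ i + c < t.numLeaves) :
    leftLeaves (deleteLeaves t i c) =
      leftLeaves t + min i (leftLeaves t) - min (i + c) (leftLeaves t) := by
  induction c generalizing t with
  | zero => rw [deleteLeaves]; omega
  | succ c ih =>
    have leaves := numLeaves_deleteLeaf t (i + c)
    have left := leftLeaves_deleteLeaf (t := t) (i := i + c) (by omega) (by omega)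
    rw [deleteLeaves, ih (by omega) (by omega) (by omega), left]
    omega

namespace PBT

theorem numLeaves {n : ℕ} (T : PBT n) : T.1.numLeaves = n + 1 := by
  rw [numLeaves_eq_numNodes_succ, T.2]

theorem eq_node_nil_nil : ∀ T : PBT 1, T = ⟨.node () .nil .nil, rfl⟩ := by
  rintro ⟨_ | ⟨_, _ | _, _ | _⟩, h⟩ <;> simp [BinaryTree.numNodes] at h ⊢

theorem eq_rightTree_or_eq_leftTree (T : PBT 2) : T = rightTree ∨ T = leftTree := by
  obtain ⟨_ | ⟨_, _ | ⟨_, _ | _, _ | _⟩, _ | ⟨_, _ | _, _ | _⟩⟩, h⟩ := T <;>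
    simp [BinaryTree.numNodes, rightTree, leftTree] at h ⊢ <;> omega

theorem eq_rightTree_iff (T : PBT 2) : T = rightTree ↔ leftLeaves T.1 = 1 := by
  obtain rfl | rfl := T.eq_rightTree_or_eq_leftTree <;> decide

theorem eq_leftTree_iff (T : PBT 2) : T = leftTree ↔ leftLeaves T.1 = 2 := by
  obtain rfl | rfl := T.eq_rightTree_or_eq_leftTree <;> decide

end PBT

section OuterInner

variable {m n p a b l i j : ℕ}

theorem one_le_leftLeaves (t : BinaryTree Unit) : 1 ≤ leftLeaves t :=
  BinaryTree.numLeaves_pos _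

theorem PBT.leftLeaves_le (hn : 1 ≤ n) (T : PBT n) : leftLeaves T.1 ≤ n := by
  obtain ⟨_ | ⟨x, a, b⟩, rfl⟩ := T
  · contradiction
  · simp only [leftLeaves_node, BinaryTree.numLeaves_eq_numNodes_succ, BinaryTree.numNodes]
    omega

theorem coe_outerTree (h : Composable m n l i) (T : PBT l) :
    (outerTree h T : BinaryTree Unit) = deleteLeaves T.1 i (n - 1) :=
  rfl

theorem coe_innerTree (h : Composable m n l i) (T : PBT l) :
    (innerTree h T : BinaryTree Unit) =
      deleteLeaves (deleteLeaves T.1 (i + n) (m - i)) 0 (i - 1) :=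
  rfl

theorem leftLeaves_outerTree (h : Composable m n l i) (T : PBT l) :
    leftLeaves (outerTree h T).1 =
      leftLeaves T.1 + min i (leftLeaves T.1) - min (i + n - 1) (leftLeaves T.1) := by
  have leaves := T.numLeaves
  rw [outerTree, leftLeaves_deleteLeaves (by omega) (by omega) (by omega),
    Nat.add_sub_assoc h.2.2.1]

theorem leftLeaves_innerTree (h : Composable m n l i) (T : PBT l) (hi : i ≤ leftLeaves T.1)
    (hin : leftLeaves T.1 < i + n) :
    leftLeaves (innerTree h T).1 = leftLeaves T.1 - (i - 1) := by
  have leaves := T.numLeaves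
  have right : leftLeaves (deleteLeaves T.1 (i + n) (m - i)) = leftLeaves T.1 := by
    rw [leftLeaves_deleteLeaves (by omega) (by omega) (by omega)]
    omega
  rw [innerTree, leftLeaves_deleteLeaves, right]
  all_goals try rw [numLeaves_deleteLeaves]
  all_goals omega

theorem outerTree_outerTree_of_seq (hgh : Composable n p a j) (hf : Composable m a l i)
    (hfg : Composable m n b i) (hh : Composable b p l (i + j - 1)) (T : PBT l) :
    outerTree hfg (outerTree hh T) = outerTree hf T := by
  have leaves := T.numLeaves
  refine Subtype.ext ?_
  rw [coe_outerTree, coe_outerTree, deleteLeaves_deleteLeaves _ (by omega) (by omega) (by omega),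
    coe_outerTree, show n - 1 + (p - 1) = a - 1 by omega]

theorem innerTree_outerTree_of_seq (hgh : Composable n p a j) (hf : Composable m a l i)
    (hfg : Composable m n b i) (hh : Composable b p l (i + j - 1)) (T : PBT l) :
    innerTree hfg (outerTree hh T) = outerTree hgh (innerTree hf T) := by
  have leaves := T.numLeaves
  refine Subtype.ext ?_
  have right := deleteLeaves_comm T.1 (i := i + j - 1) (c := p - 1) (j := i + a) (e := m - i)
    (by omega) (by omega)
  have left := deleteLeaves_comm (deleteLeaves T.1 (i + a) (m - i)) (i := 0) (c := i - 1)
    (j := i + j - 1) (e := p - 1) (by omega) (by rw [numLeaves_deleteLeaves]; omega)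
  rw [show i + a - (p - 1) = i + n by omega] at right
  rw [show i + j - 1 - (i - 1) = j by omega] at left
  rw [coe_innerTree, coe_outerTree, ← right, left, coe_outerTree, coe_innerTree]

theorem innerTree_innerTree_of_seq (hgh : Composable n p a j) (hf : Composable m a l i)
    (hh : Composable b p l (i + j - 1)) (T : PBT l) :
    innerTree hgh (innerTree hf T) = innerTree hh T := by
  have leaves := T.numLeaves
  refine Subtype.ext ?_
  have right := deleteLeaves_comm (deleteLeaves T.1 (i + a) (m - i)) (i := 0) (c := i - 1)
    (j := i + j - 1 + p) (e := n - j) (by omega) (by rw [numLeaves_deleteLeaves]; omega)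
  rw [show i + j - 1 + p - (i - 1) = j + p by omega] at right
  rw [coe_innerTree, coe_innerTree, ← right,
    deleteLeaves_deleteLeaves T.1 (by omega) (by omega) (by omega),
    deleteLeaves_deleteLeaves _ (by omega) (by omega) (by rw [numLeaves_deleteLeaves]; omega),
    coe_innerTree, show n - j + (m - i) = b - (i + j - 1) by omega,
    show j - 1 + (i - 1) = i + j - 1 - 1 by omega]

theorem outerTree_outerTree_of_par (hij : i < j) (hfg : Composable m n a i)
    (hh : Composable a p l (j + n - 1)) (hfh : Composable m p b j) (hg : Composable b n l i)
    (T : PBT l) : outerTree hfg (outerTree hh T) = outerTree hfh (outerTree hg T) := by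
  have leaves := T.numLeaves
  refine Subtype.ext ?_
  rw [coe_outerTree, coe_outerTree, deleteLeaves_comm _ (by omega) (by omega),
    show j + n - 1 - (n - 1) = j by omega, coe_outerTree, coe_outerTree]

theorem innerTree_outerTree_of_par_left (hij : i < j) (hfg : Composable m n a i)
    (hh : Composable a p l (j + n - 1)) (hg : Composable b n l i)
    (T : PBT l) : innerTree hfg (outerTree hh T) = innerTree hg T := by
  have leaves := T.numLeaves
  refine Subtype.ext ?_
  rw [coe_innerTree, coe_outerTree, deleteLeaves_deleteLeaves T.1 (by omega) (by omega) (by omega),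
    coe_innerTree, show m - i + (p - 1) = b - i by omega]

theorem innerTree_outerTree_of_par_right (hij : i < j)
    (hh : Composable a p l (j + n - 1)) (hfh : Composable m p b j) (hg : Composable b n l i)
    (T : PBT l) : innerTree hfh (outerTree hg T) = innerTree hh T := by
  have leaves := T.numLeaves
  refine Subtype.ext ?_
  have right := deleteLeaves_comm T.1 (i := i) (c := n - 1) (j := j + n - 1 + p) (e := m - j)
    (by omega) (by omega)
  rw [show j + n - 1 + p - (n - 1) = j + p by omega] at right
  rw [coe_innerTree, coe_outerTree, ← right,
    deleteLeaves_deleteLeaves _ (by omega) (by omega) (by rw [numLeaves_deleteLeaves]; omega),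
    coe_innerTree, show m - j = a - (j + n - 1) by omega,
    show j - 1 + (n - 1) = j + n - 1 - 1 by omega]

end OuterInner

section TreeOperad

variable {k : Type u} [Field k] {P : ℕ → Type v} [∀ n, AddCommGroup (P n)] [∀ n, Module k (P n)]
  {O : OperadData P} {π : P 2} {m n l : ℕ}

namespace TreeHom

@[simp]
theorem val_mk (φ : PBT n → P n) (T : PBT n) : (TreeHom.mk k φ).val T = φ T := by
  simp [val, TreeHom.mk]

@[simp]
theorem val_const (x : P n) (T : PBT n) : (const k x).val T = x :=
  val_mk _ T

theorem ext_val {F G : TreeHom k P n} (h : ∀ T, F.val T = G.val T) : F = G :=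
  Finsupp.lhom_ext' fun T => LinearMap.ext_ring (h T)

@[simp]
theorem val_add (F G : TreeHom k P n) (T : PBT n) : (F + G).val T = F.val T + G.val T :=
  rfl

@[simp]
theorem val_sub (F G : TreeHom k P n) (T : PBT n) : (F - G).val T = F.val T - G.val T :=
  rfl

@[simp]
theorem val_neg (F : TreeHom k P n) (T : PBT n) : (-F).val T = -F.val T :=
  rfl

@[simp]
theorem val_zero (T : PBT n) : (0 : TreeHom k P n).val T = 0 :=
  rfl

@[simp]
theorem val_smul (c : k) (F : TreeHom k P n) (T : PBT n) : (c • F).val T = c • F.val T :=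
  rfl

@[simp]
theorem val_zsmul (c : ℤ) (F : TreeHom k P n) (T : PBT n) : (c • F).val T = c • F.val T :=
  rfl

theorem val_sum {ι : Type*} (s : Finset ι) (F : ι → TreeHom k P n) (T : PBT n) :
    (∑ i ∈ s, F i).val T = ∑ i ∈ s, (F i).val T :=
  LinearMap.sum_apply s F _

theorem eq_const (R : TreeHom k P 1) : R = const k (R.val ⟨.node () .nil .nil, rfl⟩) :=
  ext_val fun T => by rw [val_const, T.eq_node_nil_nil]

end TreeHom

theorem treeOperad_comp_val {i : ℕ} (h : Composable m n l i)
    (F : TreeHom k P m) (G : TreeHom k P n) (T : PBT l) :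
    ((treeOperad k O).comp i h F G).val T =
      O.comp i h (F.val (outerTree h T)) (G.val (innerTree h T)) :=
  TreeHom.val_mk _ T

theorem treeOperad_comp_const {i : ℕ} (h : Composable m n l i) (x : P m) (y : P n) :
    (treeOperad k O).comp i h (TreeHom.const k x) (TreeHom.const k y) =
      TreeHom.const k (O.comp i h x y) := by
  simp only [treeOperad, TreeHom.val_const]
  rfl

theorem isNSOperad_treeOperad (hO : IsNSOperad k O) : IsNSOperad k (treeOperad k O) where
  add_comp h f f' g := TreeHom.ext_val fun T => by
    simp only [treeOperad_comp_val, TreeHom.val_add, hO.add_comp]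
  smul_comp h c f g := TreeHom.ext_val fun T => by
    simp only [treeOperad_comp_val, TreeHom.val_smul, hO.smul_comp]
  comp_add h f g g' := TreeHom.ext_val fun T => by
    simp only [treeOperad_comp_val, TreeHom.val_add, hO.comp_add]
  comp_smul h c f g := TreeHom.ext_val fun T => by
    simp only [treeOperad_comp_val, TreeHom.val_smul, hO.comp_smul]
  comp_seq hgh hf hfg hh f g h := TreeHom.ext_val fun T => by
    simp only [treeOperad_comp_val]
    rw [hO.comp_seq hgh hf hfg hh, outerTree_outerTree_of_seq hgh hf hfg hh,
      innerTree_outerTree_of_seq hgh hf hfg hh, innerTree_innerTree_of_seq hgh hf hh]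
  comp_par hij hfg hh hfh hg f g h := TreeHom.ext_val fun T => by
    simp only [treeOperad_comp_val]
    rw [hO.comp_par hij hfg hh hfh hg, outerTree_outerTree_of_par hij hfg hh hfh hg,
      innerTree_outerTree_of_par_left hij hfg hh hg,
      innerTree_outerTree_of_par_right hij hh hfh hg]
  comp_one h f := TreeHom.ext_val fun T => by
    have one_val (S : PBT 1) : (treeOperad k O).one.val S = O.one := TreeHom.val_const _ S
    rw [treeOperad_comp_val, one_val, hO.comp_one]
    rfl
  one_comp h f := TreeHom.ext_val fun T => by
    have one_val (S : PBT 1) : (treeOperad k O).one.val S = O.one := TreeHom.val_const _ S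
    rw [treeOperad_comp_val, one_val, hO.one_comp]
    rfl

theorem isMultiplication_treeOperad_iff :
    IsMultiplication (treeOperad k O) (TreeHom.const k π) ↔ IsMultiplication O π := by
  simp only [IsMultiplication, treeOperad_comp_const]
  refine ⟨fun h => ?_, congrArg _⟩
  let T : PBT 3 := ⟨.node () .nil rightTree.1, rfl⟩
  simpa only [TreeHom.val_const] using congrArg (TreeHom.val · T) h

end TreeOperad

/-! ### The Rota–Baxter identity for `θ` -/

section Theta

variable {k : Type u} [Field k] {P : ℕ → Type v} [∀ n, AddCommGroup (P n)] [∀ n, Module k (P n)]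
  {O : OperadData P} (hQ : IsNSOperad k (treeOperad k O)) {π : P 2} {m n s : ℕ}

theorem circₗ_treeOperad_val_congr {l i : ℕ} (h : Composable m n l (i + 1))
    {F F' : TreeHom k P m} {G G' : TreeHom k P n} {T : PBT l}
    (hF : F.val (outerTree h T) = F'.val (outerTree h T))
    (hG : G.val (innerTree h T) = G'.val (innerTree h T)) :
    (hQ.circₗ l i F G).val T = (hQ.circₗ l i F' G').val T := by
  rw [← hQ.comp_eq_circₗ h, ← hQ.comp_eq_circₗ h, treeOperad_comp_val, treeOperad_comp_val, hF,
    hG]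

theorem contractionₗ_treeOperad_val (F : TreeHom k P (m + 1)) (G : TreeHom k P n) (T : PBT s) :
    (hQ.contractionₗ s F G).val T =
      ∑ i ∈ Finset.range n, (-1 : ℤ) ^ (i * m) • (hQ.circₗ s i G F).val T := by
  simp only [hQ.contractionₗ_apply, TreeHom.val_sum, TreeHom.val_zsmul]

section Values

variable (hm : 1 ≤ m) (F : TreeHom k P m) {T : PBT (m + 1)}

theorem treeTheta_val_of_leftLeaves_eq_one (hT : leftLeaves T.1 = 1) :
    (treeTheta k O π hm F).val T = (hQ.rightGraft (TreeHom.const k π) m F).val T := by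
  rw [treeTheta, TreeHom.val_mk, hQ.comp_eq_circₗ (i := 1),
    if_pos ((PBT.eq_rightTree_iff _).2 (by rw [leftLeaves_outerTree]; omega))]
  rfl

theorem treeTheta_val_of_leftLeaves_eq_succ (hT : leftLeaves T.1 = m + 1) :
    (treeTheta k O π hm F).val T = (hQ.leftGraft (TreeHom.const k π) m F).val T := by
  rw [treeTheta, TreeHom.val_mk, hQ.comp_eq_circₗ (i := 0),
    if_neg (by rw [PBT.eq_rightTree_iff, leftLeaves_outerTree]; omega),
    if_pos ((PBT.eq_leftTree_iff _).2 (by rw [leftLeaves_outerTree]; omega))]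
  rfl

theorem treeTheta_val_of_leftLeaves_ne (hone : leftLeaves T.1 ≠ 1)
    (hsucc : leftLeaves T.1 ≠ m + 1) : (treeTheta k O π hm F).val T = 0 := by
  have pos := one_le_leftLeaves T.1
  have le := T.leftLeaves_le (Nat.le_add_left 1 m)
  rw [treeTheta, TreeHom.val_mk,
    if_neg (by rw [PBT.eq_rightTree_iff, leftLeaves_outerTree]; omega),
    if_neg (by rw [PBT.eq_leftTree_iff, leftLeaves_outerTree]; omega)]

end Values

theorem circₗ_treeOperad_val_eq_zero_of_left {l i : ℕ} (h : Composable m n l (i + 1))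
    {F : TreeHom k P m} (G : TreeHom k P n) {T : PBT l} (hF : F.val (outerTree h T) = 0) :
    (hQ.circₗ l i F G).val T = 0 := by
  rw [circₗ_treeOperad_val_congr hQ h (F' := 0) hF rfl, map_zero,
    LinearMap.zero_apply, TreeHom.val_zero]

theorem circₗ_treeOperad_val_eq_zero_of_right {l i : ℕ} (h : Composable m n l (i + 1))
    (F : TreeHom k P m) {G : TreeHom k P n} {T : PBT l} (hG : G.val (innerTree h T) = 0) :
    (hQ.circₗ l i F G).val T = 0 := by
  rw [circₗ_treeOperad_val_congr hQ h (G' := 0) rfl hG, map_zero, TreeHom.val_zero]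

section Contraction

variable (hm : 1 ≤ m) (hn : 1 ≤ n) (hs : n + m = s) (F : TreeHom k P m) (G : TreeHom k P n)
  {T : PBT (s + 1)}
include hs

theorem contractionₗ_treeTheta_val_of_leftLeaves_eq_one
    (hπ : IsMultiplication (treeOperad k O) (TreeHom.const k π)) (hT : leftLeaves T.1 = 1) :
    (hQ.contractionₗ (s + 1) (treeTheta k O π hm F) (treeTheta k O π hn G)).val T =
      (hQ.rightGraft (TreeHom.const k π) s (hQ.cupₗ (TreeHom.const k π) s F G +
        hQ.contractionₗ s (treeTheta k O π hm F) G)).val T := by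
  have outer : (hQ.contractionₗ (s + 1) (treeTheta k O π hm F) (treeTheta k O π hn G)).val T =
      (hQ.contractionₗ (s + 1) (treeTheta k O π hm F)
        (hQ.rightGraft (TreeHom.const k π) n G)).val T := by
    rw [contractionₗ_treeOperad_val, contractionₗ_treeOperad_val]
    refine Finset.sum_congr rfl fun i hi => congrArg _ ?_
    rw [Finset.mem_range] at hi
    refine circₗ_treeOperad_val_congr hQ (by omega)
      (treeTheta_val_of_leftLeaves_eq_one hQ hn G ?_) rfl
    rw [leftLeaves_outerTree]
    omega
  have inner : (hQ.circₗ (s + 1) 0 (hQ.rightGraft (TreeHom.const k π) n G)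
        (treeTheta k O π hm F)).val T =
      (hQ.circₗ (s + 1) 0 (hQ.rightGraft (TreeHom.const k π) n G)
        (hQ.rightGraft (TreeHom.const k π) m F)).val T := by
    refine circₗ_treeOperad_val_congr hQ (by omega) rfl
      (treeTheta_val_of_leftLeaves_eq_one hQ hm F ?_)
    rw [leftLeaves_innerTree _ _ (by omega) (by omega), hT]
  rw [outer, hQ.contractionₗ_rightGraft _ hs, TreeHom.val_add, inner,
    hπ.circₗ_rightGraft_rightGraft hQ hm hn (by omega), ← TreeHom.val_add, ← map_add]

theorem contractionₗ_treeTheta_val_of_leftLeaves_eq_succ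
    (hπ : IsMultiplication (treeOperad k O) (TreeHom.const k π)) (hT : leftLeaves T.1 = s + 1) :
    (hQ.contractionₗ (s + 1) (treeTheta k O π hm F) (treeTheta k O π hn G)).val T =
      (hQ.leftGraft (TreeHom.const k π) s (hQ.contractionₗ s (treeTheta k O π hm F) G -
        (-1 : ℤ) ^ (n * m) • hQ.cupₗ (TreeHom.const k π) s G F)).val T := by
  have outer : (hQ.contractionₗ (s + 1) (treeTheta k O π hm F) (treeTheta k O π hn G)).val T =
      (hQ.contractionₗ (s + 1) (treeTheta k O π hm F)
        (hQ.leftGraft (TreeHom.const k π) n G)).val T := by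
    rw [contractionₗ_treeOperad_val, contractionₗ_treeOperad_val]
    refine Finset.sum_congr rfl fun i hi => congrArg _ ?_
    rw [Finset.mem_range] at hi
    refine circₗ_treeOperad_val_congr hQ (by omega)
      (treeTheta_val_of_leftLeaves_eq_succ hQ hn G ?_) rfl
    rw [leftLeaves_outerTree]
    omega
  have inner : (hQ.circₗ (s + 1) n (hQ.leftGraft (TreeHom.const k π) n G)
        (treeTheta k O π hm F)).val T =
      (hQ.circₗ (s + 1) n (hQ.leftGraft (TreeHom.const k π) n G)
        (hQ.leftGraft (TreeHom.const k π) m F)).val T := by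
    refine circₗ_treeOperad_val_congr hQ (by omega) rfl
      (treeTheta_val_of_leftLeaves_eq_succ hQ hm F ?_)
    rw [leftLeaves_innerTree _ _ (by omega) (by omega)]
    omega
  rw [outer, hQ.contractionₗ_leftGraft _ hs, TreeHom.val_add, TreeHom.val_zsmul, inner,
    hπ.circₗ_leftGraft_leftGraft hQ hm hn (by omega), map_sub, map_zsmul, TreeHom.val_sub,
    TreeHom.val_neg, TreeHom.val_zsmul, smul_neg, ← sub_eq_add_neg]

theorem contractionₗ_treeTheta_val_of_leftLeaves_ne (hone : leftLeaves T.1 ≠ 1)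
    (hsucc : leftLeaves T.1 ≠ s + 1) :
    (hQ.contractionₗ (s + 1) (treeTheta k O π hm F) (treeTheta k O π hn G)).val T =
      (hQ.circₗ (s + 1) 0 (treeTheta k O π hn G) (treeTheta k O π hm F)).val T +
        (-1 : ℤ) ^ (n * m) •
          (hQ.circₗ (s + 1) n (treeTheta k O π hn G) (treeTheta k O π hm F)).val T := by
  have pos := one_le_leftLeaves T.1
  have le := T.leftLeaves_le (Nat.le_add_left 1 s)
  have middle : ∀ i ∈ Finset.range (n + 1), i ≠ 0 ∧ i ≠ n → (-1 : ℤ) ^ (i * m) •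
      (hQ.circₗ (s + 1) i (treeTheta k O π hn G) (treeTheta k O π hm F)).val T = 0 := by
    intro i hi hne
    rw [Finset.mem_range] at hi
    rw [circₗ_treeOperad_val_eq_zero_of_left hQ (by omega) _ (treeTheta_val_of_leftLeaves_ne hn G
      (by rw [leftLeaves_outerTree]; omega) (by rw [leftLeaves_outerTree]; omega)), smul_zero]
  rw [contractionₗ_treeOperad_val, Finset.sum_eq_add 0 n (by omega) middle (by simp) (by simp),
    zero_mul, pow_zero, one_smul]

theorem circₗ_treeTheta_treeTheta_val_of_leftLeaves_ne
    (hπ : IsMultiplication (treeOperad k O) (TreeHom.const k π)) (hone : leftLeaves T.1 ≠ 1)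
    (hsucc : leftLeaves T.1 ≠ s + 1) :
    (hQ.circₗ (s + 1) 0 (treeTheta k O π hn G) (treeTheta k O π hm F)).val T =
      (hQ.circₗ (s + 1) m (treeTheta k O π hm F) (treeTheta k O π hn G)).val T := by
  have pos := one_le_leftLeaves T.1
  have le := T.leftLeaves_le (Nat.le_add_left 1 s)
  have hGF : Composable (n + 1) (m + 1) (s + 1) (0 + 1) := by omega
  have hFG : Composable (m + 1) (n + 1) (s + 1) (m + 1) := by omega
  rcases lt_trichotomy (leftLeaves T.1) (m + 1) with hT | hT | hT
  · rw [circₗ_treeOperad_val_eq_zero_of_right hQ hGF _ (treeTheta_val_of_leftLeaves_ne hm F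
        (by rw [leftLeaves_innerTree] <;> omega) (by rw [leftLeaves_innerTree] <;> omega)),
      circₗ_treeOperad_val_eq_zero_of_left hQ hFG _ (treeTheta_val_of_leftLeaves_ne hm F
        (by rw [leftLeaves_outerTree]; omega) (by rw [leftLeaves_outerTree]; omega))]
  · rw [circₗ_treeOperad_val_congr hQ hGF
        (treeTheta_val_of_leftLeaves_eq_one hQ hn G (by rw [leftLeaves_outerTree]; omega))
        (treeTheta_val_of_leftLeaves_eq_succ hQ hm F (by rw [leftLeaves_innerTree] <;> omega)),
      circₗ_treeOperad_val_congr hQ hFG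
        (treeTheta_val_of_leftLeaves_eq_succ hQ hm F (by rw [leftLeaves_outerTree]; omega))
        (treeTheta_val_of_leftLeaves_eq_one hQ hn G (by rw [leftLeaves_innerTree] <;> omega)),
      hπ.circₗ_rightGraft_leftGraft hQ hm hn (by omega)]
  · rw [circₗ_treeOperad_val_eq_zero_of_left hQ hGF _ (treeTheta_val_of_leftLeaves_ne hn G
        (by rw [leftLeaves_outerTree]; omega) (by rw [leftLeaves_outerTree]; omega)),
      circₗ_treeOperad_val_eq_zero_of_right hQ hFG _ (treeTheta_val_of_leftLeaves_ne hn G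
        (by rw [leftLeaves_innerTree] <;> omega) (by rw [leftLeaves_innerTree] <;> omega))]

end Contraction

include hQ in
theorem treeTheta_add (hm : 1 ≤ m) (F F' : TreeHom k P m) :
    treeTheta k O π hm (F + F') = treeTheta k O π hm F + treeTheta k O π hm F' := by
  refine TreeHom.ext_val fun T => ?_
  rw [TreeHom.val_add]
  by_cases hone : leftLeaves T.1 = 1
  · simp only [treeTheta_val_of_leftLeaves_eq_one hQ _ _ hone, map_add, TreeHom.val_add]
  by_cases hsucc : leftLeaves T.1 = m + 1
  · simp only [treeTheta_val_of_leftLeaves_eq_succ hQ _ _ hsucc, map_add, TreeHom.val_add]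
  · simp only [treeTheta_val_of_leftLeaves_ne _ _ hone hsucc, add_zero]

include hQ in
theorem treeTheta_smul (hm : 1 ≤ m) (c : k) (F : TreeHom k P m) :
    treeTheta k O π hm (c • F) = c • treeTheta k O π hm F := by
  refine TreeHom.ext_val fun T => ?_
  rw [TreeHom.val_smul]
  by_cases hone : leftLeaves T.1 = 1
  · simp only [treeTheta_val_of_leftLeaves_eq_one hQ _ _ hone, map_smul, TreeHom.val_smul]
  by_cases hsucc : leftLeaves T.1 = m + 1
  · simp only [treeTheta_val_of_leftLeaves_eq_succ hQ _ _ hsucc, map_smul, TreeHom.val_smul]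
  · simp only [treeTheta_val_of_leftLeaves_ne _ _ hone hsucc, smul_zero]

theorem treeTheta_descendentBracket
    (hπ : IsMultiplication (treeOperad k O) (TreeHom.const k π)) (hm : 1 ≤ m) (hn : 1 ≤ n)
    (F : TreeHom k P m) (G : TreeHom k P n) :
    treeTheta k O π (Nat.le_add_right_of_le hm) (descendentBracket (treeOperad k O)
        (TreeHom.const k π) (treeTheta k O π) hm hn rfl F G) =
      hQ.gerstenhaberₗ (m + n + 1) (treeTheta k O π hm F) (treeTheta k O π hn G) := by
  refine TreeHom.ext_val fun T => ?_
  rw [hQ.descendentBracket_eq, hQ.gerstenhaberₗ_apply, TreeHom.val_sub, TreeHom.val_zsmul]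
  by_cases hone : leftLeaves T.1 = 1
  · rw [treeTheta_val_of_leftLeaves_eq_one hQ _ _ hone,
      contractionₗ_treeTheta_val_of_leftLeaves_eq_one hQ hm hn (add_comm n m) F G hπ hone,
      contractionₗ_treeTheta_val_of_leftLeaves_eq_one hQ hn hm rfl G F hπ hone,
      ← TreeHom.val_zsmul, ← TreeHom.val_sub, ← map_zsmul (hQ.rightGraft _ _),
      ← map_sub, hQ.cupBracketₗ_apply,
      smul_add]
    congr 2
    abel
  by_cases hsucc : leftLeaves T.1 = m + n + 1
  · rw [treeTheta_val_of_leftLeaves_eq_succ hQ _ _ hsucc,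
      contractionₗ_treeTheta_val_of_leftLeaves_eq_succ hQ hm hn (add_comm n m) F G hπ hsucc,
      contractionₗ_treeTheta_val_of_leftLeaves_eq_succ hQ hn hm rfl G F hπ hsucc,
      ← TreeHom.val_zsmul, ← TreeHom.val_sub, ← map_zsmul (hQ.leftGraft _ _),
      ← map_sub, hQ.cupBracketₗ_apply,
      smul_sub, neg_one_pow_smul_smul, mul_comm n m]
    congr 2
    abel
  · rw [treeTheta_val_of_leftLeaves_ne _ _ hone hsucc,
      contractionₗ_treeTheta_val_of_leftLeaves_ne hQ hm hn (add_comm n m) F G hone hsucc,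
      contractionₗ_treeTheta_val_of_leftLeaves_ne hQ hn hm rfl G F hone hsucc,
      circₗ_treeTheta_treeTheta_val_of_leftLeaves_ne hQ hm hn (add_comm n m) F G hπ hone hsucc,
      circₗ_treeTheta_treeTheta_val_of_leftLeaves_ne hQ hn hm rfl G F hπ hone hsucc,
      smul_add, neg_one_pow_smul_smul, mul_comm n m]
    abel

theorem isRelativeRotaBaxter_treeTheta
    (hπ : IsMultiplication (treeOperad k O) (TreeHom.const k π)) :
    IsRelativeRotaBaxter hQ (TreeHom.const k π) (treeTheta k O π) where
  apply_add := treeTheta_add hQ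
  apply_smul := treeTheta_smul hQ
  apply_descendentBracket := treeTheta_descendentBracket hQ hπ

end Theta

/-! ### Maurer–Cartan elements -/

section MaurerCartan

variable {k : Type u} [Field k] {P : ℕ → Type v} [∀ n, AddCommGroup (P n)] [∀ n, Module k (P n)]
  {O : OperadData P} {π : P 2}

theorem TreeHom.eq_iff_val_rightTree_leftTree {F G : TreeHom k P 2} :
    F = G ↔ F.val rightTree = G.val rightTree ∧ F.val leftTree = G.val leftTree := by
  refine ⟨by rintro rfl; exact ⟨rfl, rfl⟩, fun h => TreeHom.ext_val fun T => ?_⟩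
  obtain rfl | rfl := T.eq_rightTree_or_eq_leftTree
  exacts [h.1, h.2]

theorem treeTheta_const_val_rightTree (r : P 1) :
    (treeTheta k O π le_rfl (TreeHom.const k r)).val rightTree =
      -O.comp (l := 2) 2 (by omega) π r := by
  rw [treeTheta, TreeHom.val_mk, if_pos (by decide), treeOperad_comp_const, TreeHom.val_const,
    pow_one, neg_one_smul]

theorem treeTheta_const_val_leftTree (r : P 1) :
    (treeTheta k O π le_rfl (TreeHom.const k r)).val leftTree =
      -O.comp (l := 2) 1 (by omega) π r := by
  rw [treeTheta, TreeHom.val_mk, if_neg (by decide), if_pos (by decide), treeOperad_comp_const,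
    TreeHom.val_const]

theorem isMaurerCartan_const_iff [NeZero (2 : k)] (hO : IsNSOperad k O) (r : P 1) :
    IsMaurerCartan (L := TreeHom k P) (treeDerivedBracket k O π) (TreeHom.const k r) ↔
      IsAveragingElement O π r := by
  have comp_theta_val (T : PBT 2) : (-(treeOperad k O).comp (l := 2) 1 (by omega)
        (TreeHom.const k r) (treeTheta k O π le_rfl (TreeHom.const k r))).val T =
      O.comp (l := 2) 1 (by omega) r (-(treeTheta k O π le_rfl (TreeHom.const k r)).val T) := by
    rw [TreeHom.val_neg, treeOperad_comp_val, TreeHom.val_const, hO.comp_eq_circₗ,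
      hO.comp_eq_circₗ, map_neg]
    rfl
  refine (isMaurerCartan_descendentBracket_iff k (treeTheta k O π) (TreeHom.const k r)).trans ?_
  rw [TreeHom.eq_iff_val_rightTree_leftTree, comp_theta_val, comp_theta_val,
    treeTheta_const_val_rightTree, treeTheta_const_val_leftTree, neg_neg, neg_neg,
    treeOperad_comp_const, treeOperad_comp_const, TreeHom.val_const, TreeHom.val_const,
    IsAveragingElement]
  exact ⟨fun ⟨right, left⟩ => ⟨left, left.symm.trans right⟩,
    fun ⟨left, both⟩ => ⟨left.trans both, left⟩⟩

theorem isMaurerCartan_iff_exists_const [NeZero (2 : k)] (hO : IsNSOperad k O)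
    (R : TreeHom k P 1) :
    IsMaurerCartan (L := TreeHom k P) (treeDerivedBracket k O π) R ↔
      ∃ r : P 1, IsAveragingElement O π r ∧ R = TreeHom.const k r := by
  refine ⟨fun hR => ⟨_, ?_, R.eq_const⟩, ?_⟩
  · rwa [← isMaurerCartan_const_iff hO, ← R.eq_const]
  · rintro ⟨r, hr, rfl⟩
    exact (isMaurerCartan_const_iff hO r).2 hr

theorem mainTheorem11_general [NeZero (2 : k)] (O : OperadData P) (hO : IsNSOperad k O)
    (π : P 2) :
    IsNSOperad k (treeOperad k O) ∧
    (IsMultiplication O π ↔ IsMultiplication (treeOperad k O) (TreeHom.const k π)) ∧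
    (IsMultiplication O π →
      IsGradedLieBracket k (L := TreeHom k P) (treeDerivedBracket k O π) ∧
      (∀ r : P 1, IsAveragingElement O π r ↔
        IsMaurerCartan (L := TreeHom k P) (treeDerivedBracket k O π) (TreeHom.const k r)) ∧
      (∀ R : TreeHom k P 1, IsMaurerCartan (L := TreeHom k P) (treeDerivedBracket k O π) R ↔
        ∃ r : P 1, IsAveragingElement O π r ∧ R = TreeHom.const k r)) := by
  refine ⟨isNSOperad_treeOperad hO, isMultiplication_treeOperad_iff.symm, fun hπ =>
    ⟨?_, fun r => (isMaurerCartan_const_iff hO r).symm, isMaurerCartan_iff_exists_const hO⟩⟩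
  have hπQ : IsMultiplication (treeOperad k O) (TreeHom.const k π) :=
    isMultiplication_treeOperad_iff.2 hπ
  exact (isRelativeRotaBaxter_treeTheta (isNSOperad_treeOperad hO)
    hπQ).isGradedLieBracket_descendentBracket hπQ

end MaurerCartan

end AveragingOperad

open AveragingOperad in
theorem mainTheorem11 {k : Type*} [Field k] [CharZero k] {P : ℕ → Type*}
    [∀ n, AddCommGroup (P n)] [∀ n, Module k (P n)] (O : OperadData P) (hO : IsNSOperad k O)
    (π : P 2) :
    IsNSOperad k (treeOperad k O) ∧
    (IsMultiplication O π ↔ IsMultiplication (treeOperad k O) (TreeHom.const k π)) ∧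
    (IsMultiplication O π →
      IsGradedLieBracket k (L := TreeHom k P) (treeDerivedBracket k O π) ∧
      (∀ r : P 1, IsAveragingElement O π r ↔
        IsMaurerCartan (L := TreeHom k P) (treeDerivedBracket k O π) (TreeHom.const k r)) ∧
      (∀ R : TreeHom k P 1, IsMaurerCartan (L := TreeHom k P) (treeDerivedBracket k O π) R ↔
        ∃ r : P 1, IsAveragingElement O π r ∧ R = TreeHom.const k r)) :=
  mainTheorem11_general O hO π
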